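/- Let $W(\mathbb R)$ be the set of functions $f:\mathbb R\to\mathbb C$ of the form $f(x)=\int_{\mathbb R}e^{ixy}\,d\mu(y)$, where $\mu$ is a complex Borel measure on $\mathbb R$ of finite total variation, with $\|f\|_W=\operatorname{var}\mu$ (the measure $\mu$ is uniquely determined by $f$). Let $W^+(\mathbb R)$ be the set of those $f$ for which $\mu$ can be taken to be a finite positive measure, let $W_0(\mathbb R)$ be the set of functions $f(x)=\int_{\mathbb R}e^{ixy}g(y)\,dy$ with $g\in L_1(\mathbb R)$, and let $W_1(\mathbb R)$ be the set of functions $c+f_0$ with $c\in\mathbb C$ and $f_0\in W_0(\mathbb R)$. For $f:\mathbb R\to\mathbb C$ let $\ell_f$ be the continuous function that satisfies $\ell_f(k)=f(k)$ for all $k\in\mathbb Z$ and is linear on every interval $[k,k+1]$, $k\in\mathbb Z$. Theorem. If $f\in W(\mathbb R)$, then $\ell_f\in W(\mathbb R)$ and $\|\ell_f\|_W\le\|f\|_W$. This inequality is sharp on the whole class: the constant $1$ cannot be replaced by a smaller one, and moreover, for every $f\in W(\mathbb R)$, the dilations $f_h(x)=f(hx)$, $h>0$, satisfy $\lim_{h\to0+}\|\ell_{f_h}\|_W=\|f\|_W$.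 If $f$ belongs to $W_0(\mathbb R)$, to $W_1(\mathbb R)$ or to $W^+(\mathbb R)$, then $\ell_f$ belongs to the same class. -/

import Mathlib

open MeasureTheory Set Filter Topology
open scoped ENNReal

namespace WienerAlgebra

/-- The function `f` is the Fourier integral `f(x) = ∫ e^{ixy} dμ(y)` of the complex Borel
measure `μ` on the real line, whose total variation is finite. -/
def IsFourierIntegralOf (f : ℝ → ℂ) (μ : ComplexMeasure ℝ) : Prop :=
  μ.variation univ < ∞ ∧
    ∀ x : ℝ, f x = μ.integral (fun y : ℝ => Complex.exp (Complex.I * x * y))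
      (ContinuousLinearMap.mul ℝ ℂ)

/-- The Wiener algebra `W(ℝ)`. -/
def W : Set (ℝ → ℂ) :=
  {f | ∃ μ : ComplexMeasure ℝ, IsFourierIntegralOf f μ}

/-- The Wiener algebra `W₀(ℝ)` of Fourier integrals of Lebesgue integrable functions. -/
def W₀ : Set (ℝ → ℂ) :=
  {f | ∃ g : ℝ → ℂ, Integrable g ∧
    ∀ x : ℝ, f x = ∫ y : ℝ, Complex.exp (Complex.I * x * y) * g y}

/-- The Wiener algebra `W₁(ℝ)`: constants plus elements of `W₀(ℝ)`. -/
def W₁ : Set (ℝ → ℂ) :=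
  {f | ∃ c : ℂ, ∃ f₀ ∈ W₀, ∀ x : ℝ, f x = c + f₀ x}

/-- The class `W⁺(ℝ)` of Fourier integrals of finite positive Borel measures. -/
def Wplus : Set (ℝ → ℂ) :=
  {f | ∃ μ : Measure ℝ, IsFiniteMeasure μ ∧
    ∀ x : ℝ, f x = ∫ y : ℝ, Complex.exp (Complex.I * x * y) ∂μ}

/-- The norm of `W(ℝ)`: the total variation of the complex measure that represents `f`.
At most one measure represents `f`, so the infimum runs over a single measure if `f` is
in `W(ℝ)` (see `normW_eq`), and it is `∞` if `f` is not in `W(ℝ)`. -/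
noncomputable def normW (f : ℝ → ℂ) : ℝ≥0∞ :=
  ⨅ (μ : ComplexMeasure ℝ) (_ : IsFourierIntegralOf f μ), μ.variation univ

/-- The `f`-zigzag: the continuous function that agrees with `f` at the integers and is linear
between consecutive integers. -/
noncomputable def zigzag (f : ℝ → ℂ) (x : ℝ) : ℂ :=
  f (⌊x⌋ : ℤ) + (Int.fract x : ℝ) * (f ((⌊x⌋ + 1 : ℤ) : ℝ) - f (⌊x⌋ : ℤ))

/-- The exponential is integrable against a vector measure of finite variation. -/
theorem integrable_exp {V : Type*} [NormedAddCommGroup V] (μ : VectorMeasure ℝ V)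
    (hμ : μ.variation univ < ∞) (x : ℝ) :
    μ.Integrable (fun y : ℝ => Complex.exp (Complex.I * x * y)) := by
  have : IsFiniteMeasure μ.variation := ⟨hμ⟩
  refine Integrable.of_bound (C := 1) (by fun_prop) (Eventually.of_forall fun y => ?_)
  rw [Complex.norm_exp]
  simp

/-- The integral of the exponential against a signed measure. -/
noncomputable def signedTransform (s : SignedMeasure ℝ) (x : ℝ) : ℂ :=
  s.integral (fun y : ℝ => Complex.exp (Complex.I * x * y)) (ContinuousLinearMap.lsmul ℝ ℝ).flip

theorem signed_variation_lt_top (s : SignedMeasure ℝ) : s.variation univ < ∞ := by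
  rw [← SignedMeasure.totalVariation_eq_variation]
  exact measure_lt_top _ _

theorem integral_eq_re_add_im (μ : ComplexMeasure ℝ) (hμ : μ.variation univ < ∞) (x : ℝ) :
    μ.integral (fun y : ℝ => Complex.exp (Complex.I * x * y)) (ContinuousLinearMap.mul ℝ ℂ) =
      signedTransform (ComplexMeasure.re μ) x +
        Complex.I * signedTransform (ComplexMeasure.im μ) x := by
  set e : ℝ → ℂ := fun y : ℝ => Complex.exp (Complex.I * x * y) with he
  have hi : Integrable e μ.variation := integrable_exp μ hμ x
  have hre : (ComplexMeasure.re μ).variation ≤ (1 : ℝ≥0∞) • μ.variation := by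
    rw [one_smul]
    refine VectorMeasure.variation_le_of_forall_enorm_le fun E _ =>
      le_trans ?_ (VectorMeasure.enorm_measure_le_variation μ E)
    simp only [ComplexMeasure.re_apply]
    rw [enorm_le_iff_norm_le]
    exact Complex.abs_re_le_norm _
  have him : (ComplexMeasure.im μ).variation ≤ (1 : ℝ≥0∞) • μ.variation := by
    rw [one_smul]
    refine VectorMeasure.variation_le_of_forall_enorm_le fun E _ =>
      le_trans ?_ (VectorMeasure.enorm_measure_le_variation μ E)
    simp only [ComplexMeasure.im_apply]
    rw [enorm_le_iff_norm_le]
    exact Complex.abs_im_le_norm _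
  set P : ℂ →L[ℝ] ℝ →L[ℝ] ℂ := (ContinuousLinearMap.lsmul ℝ ℝ).flip with hP
  set Q : ℂ →L[ℝ] ℝ →L[ℝ] ℂ :=
    (ContinuousLinearMap.compL ℝ ℝ ℂ ℂ (ContinuousLinearMap.mul ℝ ℂ Complex.I)) ∘L P with hQ
  have hsum : ContinuousLinearMap.mul ℝ ℂ =
      P.bilinearComp (ContinuousLinearMap.id ℝ ℂ) Complex.reCLM +
        Q.bilinearComp (ContinuousLinearMap.id ℝ ℂ) Complex.imCLM := by
    ext a b
    conv_lhs => rw [ContinuousLinearMap.mul_apply', ← Complex.re_add_im b]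
    simp only [hP, hQ, add_apply, ContinuousLinearMap.bilinearComp_apply,
      ContinuousLinearMap.coe_id', id_eq, ContinuousLinearMap.flip_apply,
      ContinuousLinearMap.lsmul_apply, Complex.reCLM_apply, Complex.imCLM_apply,
      ContinuousLinearMap.comp_apply, ContinuousLinearMap.compL_apply,
      ContinuousLinearMap.mul_apply', Complex.real_smul]
    ring
  have h1 : μ.integral e (P.bilinearComp (ContinuousLinearMap.id ℝ ℂ) Complex.reCLM) =
      (ComplexMeasure.re μ).integral e P :=
    setToFun_congr_measure_of_integrable 1 ENNReal.one_ne_top hre _ _ e hi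
  have h2 : μ.integral e (Q.bilinearComp (ContinuousLinearMap.id ℝ ℂ) Complex.imCLM) =
      (ComplexMeasure.im μ).integral e Q :=
    setToFun_congr_measure_of_integrable 1 ENNReal.one_ne_top him _ _ e hi
  have h3 : Complex.I * (ComplexMeasure.im μ).integral e P =
      (ComplexMeasure.im μ).integral e Q :=
    VectorMeasure.continuousLinearMap_apply_integral
      (C := ContinuousLinearMap.mul ℝ ℂ Complex.I)
      (integrable_exp _ (signed_variation_lt_top _) x)
  rw [hsum, VectorMeasure.integral_add_cbm hi, h1, h2, ← h3]
  rfl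

theorem signedTransform_eq_sub (s : SignedMeasure ℝ) (x : ℝ) :
    signedTransform s x =
      charFun s.toJordanDecomposition.posPart x - charFun s.toJordanDecomposition.negPart x := by
  have h := SignedMeasure.toSignedMeasure_toJordanDecomposition s
  conv_lhs => rw [← h]
  have hp : ∀ m : Measure ℝ, [IsFiniteMeasure m] → signedTransform m.toSignedMeasure x = charFun m x := by
    intro m _
    rw [signedTransform, VectorMeasure.integral_toSignedMeasure, charFun_apply_real]
    congr with y
    ring_nf
  rw [← hp, ← hp]
  simp only [signedTransform, JordanDecomposition.toSignedMeasure]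
  exact VectorMeasure.integral_sub_vectorMeasure
    (integrable_exp _ (signed_variation_lt_top _) x) (integrable_exp _ (signed_variation_lt_top _) x)

theorem signedTransform_neg (s : SignedMeasure ℝ) (x : ℝ) :
    signedTransform s (-x) = (starRingEnd ℂ) (signedTransform s x) := by
  simp only [signedTransform_eq_sub, charFun_neg, map_sub]

theorem signed_eq_zero (s : SignedMeasure ℝ) (h : ∀ x, signedTransform s x = 0) : s = 0 := by
  rw [← SignedMeasure.toSignedMeasure_toJordanDecomposition s, JordanDecomposition.toSignedMeasure]
  have : s.toJordanDecomposition.posPart = s.toJordanDecomposition.negPart := by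
    apply Measure.ext_of_charFun
    ext x
    have := h x
    rw [signedTransform_eq_sub] at this
    exact sub_eq_zero.1 this
  simp [this]

/-- A complex measure of finite variation is determined by its Fourier integral. -/
theorem IsFourierIntegralOf.unique {f : ℝ → ℂ} {μ ν : ComplexMeasure ℝ}
    (hμ : IsFourierIntegralOf f μ) (hν : IsFourierIntegralOf f ν) : μ = ν := by
  have hd : (μ - ν).variation univ < ∞ :=
    lt_of_le_of_lt (VectorMeasure.variation_sub_le univ) (ENNReal.add_lt_top.2 ⟨hμ.1, hν.1⟩)
  have h0 : ∀ x : ℝ, signedTransform (ComplexMeasure.re (μ - ν)) x +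
      Complex.I * signedTransform (ComplexMeasure.im (μ - ν)) x = 0 := by
    intro x
    rw [← integral_eq_re_add_im _ hd, VectorMeasure.integral_sub_vectorMeasure
      (integrable_exp _ hμ.1 x) (integrable_exp _ hν.1 x), ← hμ.2 x, ← hν.2 x, sub_self]
  have h1 : ∀ x : ℝ, signedTransform (ComplexMeasure.re (μ - ν)) x -
      Complex.I * signedTransform (ComplexMeasure.im (μ - ν)) x = 0 := by
    intro x
    have h := congrArg (starRingEnd ℂ) (h0 (-x))
    simp only [signedTransform_neg, map_add, map_mul, Complex.conj_conj, Complex.conj_I,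
      map_zero] at h
    linear_combination h
  have hre := signed_eq_zero (ComplexMeasure.re (μ - ν)) fun x => by
    linear_combination (h0 x + h1 x) / 2
  have him := signed_eq_zero (ComplexMeasure.im (μ - ν)) fun x => by
    linear_combination (-Complex.I / 2) * (h0 x - h1 x) +
      signedTransform (ComplexMeasure.im (μ - ν)) x * Complex.I_mul_I
  have := ComplexMeasure.toComplexMeasure_to_signedMeasure (μ - ν)
  rw [hre, him] at this
  rw [← sub_eq_zero, ← this]
  ext s
  simp [SignedMeasure.toComplexMeasure_apply]
  rfl

/-- The norm is the total variation of the measure that represents the function. -/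
theorem normW_eq {f : ℝ → ℂ} {μ : ComplexMeasure ℝ} (hμ : IsFourierIntegralOf f μ) :
    normW f = μ.variation univ :=
  le_antisymm (iInf₂_le μ hμ) (le_iInf₂ fun ν hν => by rw [hμ.unique hν])

end WienerAlgebra

/-! Everything reduces to one exponential. Put e_y(x) = e^{ixy}. The zigzag of e_y is e_y times a
continuous 1-periodic function, whose n-th Fourier coefficient is w_n(y) = sinc²(y/2 + πn). Hence
zigzag(e_y) = Σ_n w_n(y) e_{y+2πn} (`hasSum_zigzagWeight_mul_exp`), with w_n(y) ≥ 0 and, by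
evaluation at x = 0, Σ_n w_n(y) = 1.

Integrated against a measure, this says that the zigzag operator spreads the mass at y over the
points y + 2πn by a probability distribution. So it does not increase total variation, and it
preserves positivity and absolute continuity. Constants are fixed, so W₁ follows from W₀ by
linearity.

For the dilations, f_h - zigzag(f_h) has norm at most ∫ 2(1 - w_0(hy)) d|μ|(y)
(`normW_sub_zigzag_le`). This tends to 0 by dominated convergence, since w_0 is continuous and
w_0(0) = 1, while dilation preserves the norm. -/

namespace WienerAlgebra

/-! ### The zigzag of a single exponential -/

/-- The mass that the zigzag operator moves from `y` to `y + 2πn`. -/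
noncomputable def zigzagWeight (y : ℝ) (n : ℤ) : ℝ := Real.sinc (y / 2 + Real.pi * n) ^ 2

theorem zigzagWeight_nonneg (y : ℝ) (n : ℤ) : 0 ≤ zigzagWeight y n := sq_nonneg _

theorem zigzagWeight_le_one (y : ℝ) (n : ℤ) : zigzagWeight y n ≤ 1 := by
  rw [zigzagWeight, sq_le_one_iff_abs_le_one]
  exact Real.abs_sinc_le_one _

theorem continuous_zigzagWeight (n : ℤ) : Continuous fun y => zigzagWeight y n := by
  unfold zigzagWeight
  have := Real.continuous_sinc
  fun_prop

/-- Since sin² ≤ 1, the weights are dominated by 1/(π²(n + y/2π)²), except at the at most one n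
where the argument of sinc vanishes. -/
theorem summable_zigzagWeight (y : ℝ) : Summable (zigzagWeight y) := by
  have h := ((Real.summable_one_div_int_add_rpow (y / 2 / Real.pi) 2).2 one_lt_two).mul_left
    (1 / Real.pi ^ 2)
  refine Summable.of_norm_bounded_eventually h ?_
  have hfin : {n : ℤ | y / 2 + Real.pi * n = 0}.Finite := by
    refine Set.Subsingleton.finite fun a ha b hb => ?_
    have : Real.pi * (a : ℝ) = Real.pi * b := by
      simp only [mem_ofPred_eq] at ha hb
      linarith
    exact_mod_cast mul_left_cancel₀ Real.pi_ne_zero this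
  refine hfin.subset fun n hn => ?_
  by_contra h0
  apply hn
  simp only [mem_ofPred_eq] at h0 ⊢
  rw [Real.norm_of_nonneg (zigzagWeight_nonneg _ _), zigzagWeight, Real.sinc_of_ne_zero h0, div_pow]
  have hz : (n : ℝ) + y / 2 / Real.pi = (y / 2 + Real.pi * n) / Real.pi := by
    field_simp [Real.pi_ne_zero]
    ring
  rw [Real.rpow_two, sq_abs, hz, div_pow, one_div_div, ← mul_div_assoc, one_div,
    inv_mul_cancel₀ (by positivity)]
  gcongr
  exact Real.sin_sq_le_one _

/-- This is the Fourier coefficient computation; integration by parts supplies the antiderivative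
used when a ≠ 0. -/
theorem integral_exp_mul_affine (a : ℝ) :
    ∫ x in (0 : ℝ)..1, Complex.exp (-(Complex.I * a * x)) *
      (1 + x * (Complex.exp (Complex.I * a) - 1)) = (Real.sinc (a / 2) ^ 2 : ℝ) := by
  rcases eq_or_ne a 0 with rfl | ha
  · simp
  set β : ℂ := Complex.exp (Complex.I * a) - 1 with hβ
  set c : ℂ := -(Complex.I * a) with hc
  have hc0 : c ≠ 0 := by simp [hc, ha]
  have hd : ∀ x ∈ Set.uIcc (0 : ℝ) 1,
      HasDerivAt (fun x : ℝ => Complex.exp (c * x) * ((1 + x * β) / c - β / c ^ 2))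
        (Complex.exp (-(Complex.I * a * x)) * (1 + x * β)) x := by
    intro x _
    have h1 : HasDerivAt (fun x : ℝ => (x : ℂ)) 1 x := Complex.ofRealCLM.hasDerivAt
    have h2 := (h1.const_mul c).cexp
    have h3 := (((h1.mul_const β).const_add 1).div_const c).sub_const (β / c ^ 2)
    refine (h2.mul h3).congr_deriv ?_
    rw [show -(Complex.I * a * (x : ℂ)) = c * x by rw [hc]; ring]
    field_simp
    ring
  rw [intervalIntegral.integral_eq_sub_of_hasDerivAt hd
    (by apply Continuous.intervalIntegrable; fun_prop)]
  have he : Complex.exp c * (1 + β) = 1 := by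
    rw [hβ, hc, Complex.exp_neg]
    simp
  have hs : (Real.sinc (a / 2) ^ 2 : ℝ) = (2 - 2 * Real.cos a) / a ^ 2 := by
    rw [Real.sinc_of_ne_zero (by simpa using ha), div_pow, Real.sin_sq_eq_half_sub]
    field_simp
  have hcos : β + (Complex.exp c - 1) = 2 * Complex.cos a - 2 := by
    rw [hβ, hc, Complex.two_cos]
    ring_nf
  rw [hs]
  push_cast
  simp only [mul_one, mul_zero, one_mul, zero_mul, add_zero, Complex.exp_zero]
  have hc2 : c ^ 2 = -(a : ℂ) ^ 2 := by
    rw [hc, neg_sq, mul_pow, Complex.I_sq]; ring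
  have : Complex.exp c * ((1 + β) / c - β / c ^ 2) - (1 / c - β / c ^ 2) =
      (β + (Complex.exp c - 1)) / c ^ 2 := by
    field_simp
    linear_combination (c - 1) * he
  rw [this, hcos, hc2, div_neg, ← neg_div]
  ring

theorem hasSum_zigzagWeight_mul_exp (y x : ℝ) :
    HasSum (fun n : ℤ => (zigzagWeight y n : ℂ) *
        Complex.exp (Complex.I * x * (y + 2 * Real.pi * n : ℝ)))
      (zigzag (fun t : ℝ => Complex.exp (Complex.I * t * y)) x) := by
  -- On [0, 1) this is zigzag(e_y)/e_y. Both endpoint values F(0) and F(1) are 1, so its periodic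
  -- extension is continuous.
  set F : ℝ → ℂ := fun t => Complex.exp (-(Complex.I * y * t)) *
    (1 + t * (Complex.exp (Complex.I * y) - 1)) with hF
  have hcont : Continuous (AddCircle.liftIco 1 0 F) := by
    refine AddCircle.liftIco_zero_continuous ?_ (by fun_prop)
    simp [hF, ← Complex.exp_add]
  let G : C(AddCircle (1 : ℝ), ℂ) := ⟨AddCircle.liftIco 1 0 F, hcont⟩
  have hcoeff : ∀ n : ℤ, fourierCoeff G n = zigzagWeight y n := by
    intro n
    have : fourierCoeff G n = fourierCoeff (AddCircle.liftIco 1 0 F) n := rfl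
    rw [this, fourierCoeff_liftIco_eq, fourierCoeffOn_eq_integral]
    -- Passing from y to y + 2πn absorbs the character e^{-2πint} and leaves e^{iy}, hence the
    -- affine factor, unchanged.
    have h := integral_exp_mul_affine (y + 2 * Real.pi * n)
    rw [zigzagWeight, show y / 2 + Real.pi * n = (y + 2 * Real.pi * n) / 2 by ring, ← h]
    simp only [zero_add, sub_zero, div_one, one_smul]
    refine intervalIntegral.integral_congr fun t _ => ?_
    simp only [hF, fourier_coe_apply, smul_eq_mul]
    rw [← mul_assoc, ← Complex.exp_add]
    congr 2
    · push_cast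
      ring
    · congr 2
      rw [show Complex.I * ((y + 2 * Real.pi * n : ℝ) : ℂ) =
        Complex.I * y + n * (2 * Real.pi * Complex.I) by push_cast; ring,
        Complex.exp_add, Complex.exp_int_mul_two_pi_mul_I, mul_one]
  have hsum : Summable (fourierCoeff G) := by
    rw [funext hcoeff]
    exact Complex.summable_ofReal.2 (summable_zigzagWeight y)
  have h := has_pointwise_sum_fourier_series_of_summable hsum ((Int.fract x : ℝ) : AddCircle (1 : ℝ))
  have hG : G ((Int.fract x : ℝ) : AddCircle (1 : ℝ)) = F (Int.fract x) :=
    AddCircle.liftIco_zero_coe_apply (f := F) ⟨Int.fract_nonneg x, Int.fract_lt_one x⟩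
  rw [hG] at h
  have hx : (x : ℂ) = (⌊x⌋ : ℂ) + (Int.fract x : ℝ) := by
    exact_mod_cast (Int.floor_add_fract x).symm
  convert! h.mul_left (Complex.exp (Complex.I * x * y)) using 1
  · funext n
    rw [hcoeff, fourier_coe_apply, smul_eq_mul, mul_left_comm, ← Complex.exp_add]
    congr 1
    rw [Complex.exp_eq_exp_iff_exists_int]
    -- The Fourier series is evaluated at the fractional part of x, so the exponents differ by 2πi
    -- n⌊x⌋.
    refine ⟨n * ⌊x⌋, ?_⟩
    push_cast
    rw [hx]
    ring
  · simp only [zigzag, hF]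
    push_cast
    rw [← mul_assoc, ← Complex.exp_add, mul_add, add_mul, Complex.exp_add, hx]
    rw [show Complex.I * (⌊x⌋ + (Int.fract x : ℝ)) * y + -(Complex.I * y * (Int.fract x : ℝ)) =
      Complex.I * ⌊x⌋ * y by ring, mul_one]
    ring

theorem hasSum_zigzagWeight (y : ℝ) : HasSum (zigzagWeight y) 1 := by
  have h := hasSum_zigzagWeight_mul_exp y 0
  simp [zigzag] at h
  exact Complex.hasSum_ofReal.1 (by simpa using h)

/-- As the weights sum to 1, the mass leaving y and the mass arriving at the other points are both 1
- w_0(y). -/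
theorem hasSum_abs_zigzagWeight_sub (y : ℝ) :
    HasSum (fun n : ℤ => |zigzagWeight y n - if n = 0 then 1 else 0|)
      (2 * (1 - zigzagWeight y 0)) := by
  have h1 := (hasSum_zigzagWeight y).sub (hasSum_ite_eq (0 : ℤ) (1 : ℝ))
  have h2 := h1.add (hasSum_ite_eq (0 : ℤ) (2 * (1 - zigzagWeight y 0)))
  rw [sub_self, zero_add] at h2
  convert! h2 using 2
  rename_i n
  by_cases hn : n = 0
  · subst hn
    rw [if_pos rfl, if_pos rfl, abs_of_nonpos (by linarith [zigzagWeight_le_one y 0])]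
    ring
  · simp [hn, abs_of_nonneg (zigzagWeight_nonneg y n)]

/-! ### Complex measures with a density and their Fourier integrals -/

theorem integral_withDensityᵥ_eq {X : Type*} [MeasurableSpace X] {M : Measure X} {G : X → ℂ}
    (hG : Integrable G M) {f : X → ℂ} (hf : (M.withDensityᵥ G).Integrable f) :
    (M.withDensityᵥ G).integral f (ContinuousLinearMap.mul ℝ ℂ) = ∫ x, f x * G x ∂M := by
  set ν := M.withDensityᵥ G with hν
  have hvar : ν.variation = M.withDensity fun x => ‖G x‖ₑ := Measure.variation_withDensityᵥ hG
  have hGm := hG.aestronglyMeasurable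
  have hfin : IsFiniteMeasure ν.variation := by
    rw [hvar]
    exact ⟨by simpa using! hG.2⟩
  -- The polar factor of G, equal to 0 where G vanishes. Integration against ν becomes integration
  -- of f·s against |ν|, which is checked on indicators and extended by additivity and L¹
  -- continuity.
  set s : X → ℂ := fun x => (‖G x‖ : ℂ)⁻¹ * G x with hs
  have hsm : AEStronglyMeasurable s ν.variation := by
    rw [hvar]
    refine AEStronglyMeasurable.mono_ac (withDensity_absolutelyContinuous _ _) ?_
    exact (Complex.continuous_ofReal.comp_aestronglyMeasurable hGm.norm).inv₀.mul hGm
  have hs1 : ∀ x, ‖s x‖ ≤ 1 := fun x => by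
    simp only [hs, norm_mul, norm_inv, Complex.norm_real, norm_norm]
    exact inv_mul_le_one
  have hconv : ∀ u : X → ℂ, ∫ x, u x * s x ∂ν.variation = ∫ x, u x * G x ∂M := by
    intro u
    rw [hvar, integral_withDensity_eq_integral_toReal_smul₀ hGm.enorm
      (Eventually.of_forall fun x => enorm_lt_top)]
    congr with x
    rcases eq_or_ne (G x) 0 with h0 | h0
    · simp [h0]
    · have : (‖G x‖ : ℂ) ≠ 0 := by simpa using h0
      simp only [hs, toReal_enorm, Complex.real_smul]
      field_simp
  have hint : ∀ {u : X → ℂ}, Integrable u ν.variation →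
      Integrable (fun x => u x * s x) ν.variation := fun hu =>
    hu.mul_bdd hsm (Eventually.of_forall hs1)
  rw [← hconv]
  refine Integrable.induction (fun f : X → ℂ => ν.integral f (ContinuousLinearMap.mul ℝ ℂ) =
    ∫ x, f x * s x ∂ν.variation) ?_ ?_ ?_ ?_ hf
  · intro c E hE _
    rw [VectorMeasure.integral_indicator_const _ hE, hconv]
    simp only [ContinuousLinearMap.mul_apply']
    rw [withDensityᵥ_apply hG hE, ← integral_const_mul, ← integral_indicator hE]
    congr with x
    by_cases hx : x ∈ E <;> simp [hx]
  · intro u v _ hu hv h1 h2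
    rw [VectorMeasure.integral_add hu hv, h1, h2, ← integral_add (hint hu) (hint hv)]
    simp only [Pi.add_apply, add_mul]
  · refine isClosed_eq VectorMeasure.continuous_integral ?_
    refine LipschitzWith.continuous (K := 1) (LipschitzWith.of_dist_le_mul fun u v => ?_)
    rw [dist_eq_norm, ← integral_sub (hint (L1.integrable_coeFn u)) (hint (L1.integrable_coeFn v)),
      NNReal.coe_one, one_mul, dist_eq_norm, L1.norm_eq_integral_norm]
    refine (norm_integral_le_integral_norm _).trans (integral_mono_ae
      ((hint (L1.integrable_coeFn u)).sub (hint (L1.integrable_coeFn v))).norm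
      (L1.integrable_coeFn _).norm ?_)
    filter_upwards [Lp.coeFn_sub u v] with x hx
    rw [hx, ← sub_mul, norm_mul]
    exact mul_le_of_le_one_right (norm_nonneg _) (hs1 x)
  · intro u v huv _ h
    rw [← VectorMeasure.integral_congr_ae huv, h]
    refine integral_congr_ae ?_
    filter_upwards [huv] with x hx
    rw [hx]

theorem exists_eq_withDensityᵥ {X : Type*} [MeasurableSpace X] (ν : ComplexMeasure X)
    (m : Measure X) [SigmaFinite m] (h : ∀ E, MeasurableSet E → m E = 0 → ν E = 0) :
    ∃ g : X → ℂ, Integrable g m ∧ ν = m.withDensityᵥ g := by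
  have hac : ν ≪ᵥ m.toENNRealVectorMeasure :=
    VectorMeasure.AbsolutelyContinuous.mk fun E hE h0 =>
      h E hE (by rwa [Measure.toENNRealVectorMeasure_apply_measurable hE] at h0)
  obtain ⟨hre, him⟩ := (ComplexMeasure.absolutelyContinuous_ennreal_iff _ _).1 hac
  have hint : Integrable (ν.rnDeriv m) m := ComplexMeasure.integrable_rnDeriv ν m
  refine ⟨ν.rnDeriv m, hint, ?_⟩
  ext E hE
  rw [withDensityᵥ_apply hint hE]
  have h1 := congrArg (fun s : SignedMeasure X => s E)
    (SignedMeasure.withDensityᵥ_rnDeriv_eq _ _ hre)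
  have h2 := congrArg (fun s : SignedMeasure X => s E)
    (SignedMeasure.withDensityᵥ_rnDeriv_eq _ _ him)
  simp only [withDensityᵥ_apply (SignedMeasure.integrable_rnDeriv _ _) hE,
    ComplexMeasure.re_apply, ComplexMeasure.im_apply] at h1 h2
  apply Complex.ext
  · exact Eq.trans h1.symm (integral_re hint.integrableOn)
  · exact Eq.trans h2.symm (integral_im hint.integrableOn)

section Representation

variable {X : Type*} [MeasurableSpace X] {M : Measure X} {G : X → ℂ} {φ : X → ℝ} {f : ℝ → ℂ}

theorem isFourierIntegralOf_map_withDensityᵥ (hG : Integrable G M) (hφ : Measurable φ)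
    (hf : ∀ x : ℝ, f x = ∫ p, Complex.exp (Complex.I * x * φ p) * G p ∂M) :
    IsFourierIntegralOf f ((M.withDensityᵥ G).map φ) := by
  have hfin : IsFiniteMeasure (M.withDensityᵥ G).variation := by
    rw [Measure.variation_withDensityᵥ hG]
    exact ⟨by simpa using! hG.2⟩
  refine ⟨lt_of_le_of_lt (VectorMeasure.variation_map_le univ) (measure_lt_top _ _), fun x => ?_⟩
  have hi : (M.withDensityᵥ G).Integrable fun p => Complex.exp (Complex.I * x * φ p) := by
    refine Integrable.of_bound (C := 1) (by fun_prop) (Eventually.of_forall fun y => ?_)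
    rw [Complex.norm_exp]
    simp
  have hm : AEStronglyMeasurable (fun y : ℝ => Complex.exp (Complex.I * x * y))
      ((M.withDensityᵥ G).variation.map φ) := by fun_prop
  exact (hf x).trans ((integral_withDensityᵥ_eq hG hi).symm.trans
    (VectorMeasure.integral_map hφ hm hi).symm)

/-- Only an inequality: mass carried by φ to the same point may cancel. For φ the identity nothing
cancels, whence `normW_eq_lintegral`. -/
theorem normW_le_lintegral (hG : Integrable G M) (hφ : Measurable φ)
    (hf : ∀ x : ℝ, f x = ∫ p, Complex.exp (Complex.I * x * φ p) * G p ∂M) :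
    normW f ≤ ∫⁻ p, ‖G p‖ₑ ∂M := by
  rw [normW_eq (isFourierIntegralOf_map_withDensityᵥ hG hφ hf)]
  refine (VectorMeasure.variation_map_le univ).trans ?_
  rw [Measure.map_apply hφ MeasurableSet.univ, preimage_univ, Measure.variation_withDensityᵥ hG,
    withDensity_apply _ MeasurableSet.univ, Measure.restrict_univ]

theorem normW_eq_lintegral {m : Measure ℝ} {g : ℝ → ℂ} (hg : Integrable g m)
    (hf : ∀ x : ℝ, f x = ∫ y, Complex.exp (Complex.I * x * y) * g y ∂m) :
    normW f = ∫⁻ y, ‖g y‖ₑ ∂m := by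
  have h := isFourierIntegralOf_map_withDensityᵥ hg measurable_id hf
  rw [VectorMeasure.map_id] at h
  rw [normW_eq h, Measure.variation_withDensityᵥ hg,
    withDensity_apply _ MeasurableSet.univ, Measure.restrict_univ]

theorem IsFourierIntegralOf.exists_density {μ : ComplexMeasure ℝ} (hμ : IsFourierIntegralOf f μ)
    (m : Measure ℝ) [SigmaFinite m] (h : ∀ E, MeasurableSet E → m E = 0 → μ E = 0) :
    ∃ g : ℝ → ℂ, Integrable g m ∧
      ∀ x : ℝ, f x = ∫ y, Complex.exp (Complex.I * x * y) * g y ∂m := by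
  obtain ⟨g, hg, rfl⟩ := exists_eq_withDensityᵥ μ m h
  exact ⟨g, hg, fun x => by
    rw [hμ.2, integral_withDensityᵥ_eq hg (integrable_exp _ hμ.1 x)]⟩

/-- Every complex measure has a density with respect to its own variation, so later arguments use
ordinary Bochner integrals only. -/
theorem exists_density_of_mem_W (hf : f ∈ W) :
    ∃ (m : Measure ℝ) (_ : IsFiniteMeasure m) (g : ℝ → ℂ), Integrable g m ∧
      ∀ x : ℝ, f x = ∫ y, Complex.exp (Complex.I * x * y) * g y ∂m := by
  obtain ⟨μ, hμ⟩ := hf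
  have : IsFiniteMeasure μ.variation := ⟨hμ.1⟩
  refine ⟨μ.variation, this, hμ.exists_density _ fun E _ h0 => ?_⟩
  have := VectorMeasure.enorm_measure_le_variation μ E
  rw [h0] at this
  simpa using this

end Representation

theorem normW_le_add {f f₁ f₂ : ℝ → ℂ} (h₁ : f₁ ∈ W) (h₂ : f₂ ∈ W) (h : ∀ x, f x = f₁ x + f₂ x) :
    normW f ≤ normW f₁ + normW f₂ := by
  obtain ⟨μ₁, hμ₁⟩ := h₁
  obtain ⟨μ₂, hμ₂⟩ := h₂
  have hadd : IsFourierIntegralOf f (μ₁ + μ₂) := by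
    refine ⟨(VectorMeasure.variation_add_le univ).trans_lt
      (ENNReal.add_lt_top.2 ⟨hμ₁.1, hμ₂.1⟩), fun x => ?_⟩
    rw [VectorMeasure.integral_add_vectorMeasure (integrable_exp _ hμ₁.1 x)
      (integrable_exp _ hμ₂.1 x), ← hμ₁.2, ← hμ₂.2, h]
  rw [normW_eq hadd, normW_eq hμ₁, normW_eq hμ₂]
  exact VectorMeasure.variation_add_le univ

/-! ### Weights indexed by the integers, via Tonelli and Fubini -/

section Weighted

variable {X : Type*} [MeasurableSpace X] {m : Measure X} {g : X → ℂ}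
  {c : X → ℤ → ℝ} {S : X → ℝ}

theorem lintegral_enorm_weighted (hg : AEStronglyMeasurable g m)
    (hc : ∀ n, Measurable fun z => c z n) (hS : ∀ z, HasSum (fun n => |c z n|) (S z)) :
    ∫⁻ p : X × ℤ, ‖(c p.1 p.2 : ℂ) * g p.1‖ₑ ∂m.prod Measure.count =
      ∫⁻ z, ENNReal.ofReal (S z) * ‖g z‖ₑ ∂m := by
  have hcm : Measurable fun p : X × ℤ => (c p.1 p.2 : ℂ) :=
    Complex.measurable_ofReal.comp (measurable_from_prod_countable_left hc)
  have hm : AEMeasurable (fun p : X × ℤ => ‖(c p.1 p.2 : ℂ) * g p.1‖ₑ) (m.prod Measure.count) :=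
    (hcm.aestronglyMeasurable.mul hg.comp_fst).enorm
  rw [lintegral_prod _ hm]
  refine lintegral_congr fun z => ?_
  rw [lintegral_count]
  simp only [enorm_mul]
  rw [ENNReal.tsum_mul_right, ← (hS z).tsum_eq,
    ENNReal.ofReal_tsum_of_nonneg (fun n => abs_nonneg _) (hS z).summable]
  congr 2
  funext n
  rw [← ofReal_norm, Complex.norm_real, Real.norm_eq_abs]

theorem integrable_exp_mul (hg : Integrable g m) {ψ : X → ℝ} (hψ : Measurable ψ) (x : ℝ) :
    Integrable (fun z => Complex.exp (Complex.I * x * ψ z) * g z) m := by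
  refine hg.bdd_mul (c := 1) (by fun_prop) (Eventually.of_forall fun p => ?_)
  rw [Complex.norm_exp]
  simp

theorem integrable_weighted (hg : Integrable g m)
    (hc : ∀ n, Measurable fun z => c z n) (hS : ∀ z, HasSum (fun n => |c z n|) (S z)) {C : ℝ}
    (hSC : ∀ z, S z ≤ C) :
    Integrable (fun p : X × ℤ => (c p.1 p.2 : ℂ) * g p.1) (m.prod Measure.count) := by
  have hcm : Measurable fun p : X × ℤ => (c p.1 p.2 : ℂ) :=
    Complex.measurable_ofReal.comp (measurable_from_prod_countable_left hc)
  refine ⟨hcm.aestronglyMeasurable.mul hg.aestronglyMeasurable.comp_fst, ?_⟩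
  rw [HasFiniteIntegral, lintegral_enorm_weighted hg.aestronglyMeasurable hc hS]
  calc ∫⁻ z, ENNReal.ofReal (S z) * ‖g z‖ₑ ∂m ≤ ∫⁻ z, ENNReal.ofReal C * ‖g z‖ₑ ∂m := by
        gcongr with z
        exact hSC z
    _ = ENNReal.ofReal C * ∫⁻ z, ‖g z‖ₑ ∂m := lintegral_const_mul' _ _ ENNReal.ofReal_ne_top
    _ < ∞ := ENNReal.mul_lt_top ENNReal.ofReal_lt_top hg.2

theorem integral_exp_mul_weighted [SFinite m]
    (hcg : Integrable (fun p : X × ℤ => (c p.1 p.2 : ℂ) * g p.1) (m.prod Measure.count))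
    {φ : X × ℤ → ℝ} (hφ : Measurable φ) (x : ℝ) {H : X → ℂ}
    (hH : ∀ z, HasSum (fun n => (c z n : ℂ) * Complex.exp (Complex.I * x * φ (z, n))) (H z)) :
    ∫ p, Complex.exp (Complex.I * x * φ p) * ((c p.1 p.2 : ℂ) * g p.1) ∂m.prod Measure.count =
      ∫ z, H z * g z ∂m := by
  have hint := integrable_exp_mul hcg hφ x
  rw [integral_prod _ hint]
  refine integral_congr_ae ?_
  filter_upwards [hint.prod_right_ae] with z hz
  rw [integral_countable hz]
  simp only [measureReal_def, Measure.count_singleton, ENNReal.toReal_one, one_smul]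
  rw [← ((hH z).mul_right (g z)).tsum_eq]
  refine tsum_congr fun n => ?_
  ring

end Weighted

/-! ### The zigzag of a Fourier integral -/

theorem zigzag_integral {X : Type*} [MeasurableSpace X] {m : Measure X} {F : X → ℝ → ℂ}
    (hF : ∀ t, Integrable (fun z => F z t) m) (x : ℝ) :
    zigzag (fun t => ∫ z, F z t ∂m) x = ∫ z, zigzag (F z) x ∂m := by
  simp only [zigzag]
  have h := fun s t => integral_sub (hF s) (hF t)
  have hs : ∀ s t, Integrable (fun z => F z s - F z t) m := fun s t => (hF s).sub (hF t)
  rw [integral_add (hF _) ((hs _ _).const_mul _), integral_const_mul, h]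

section Representation

variable {X : Type*} [MeasurableSpace X] {m : Measure X} {g : X → ℂ} {ψ : X → ℝ} {f : ℝ → ℂ}

theorem zigzag_eq_integral_zigzag_mul (hg : Integrable g m) (hψ : Measurable ψ)
    (hf : ∀ x : ℝ, f x = ∫ z, Complex.exp (Complex.I * x * ψ z) * g z ∂m) (x : ℝ) :
    zigzag f x = ∫ z, zigzag (fun t : ℝ => Complex.exp (Complex.I * t * ψ z)) x * g z ∂m := by
  rw [funext hf, zigzag_integral]
  · refine integral_congr_ae (Eventually.of_forall fun z => ?_)
    simp only [zigzag]
    ring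
  · exact integrable_exp_mul hg hψ

theorem measurable_add_two_pi_mul (hψ : Measurable ψ) :
    Measurable fun p : X × ℤ => ψ p.1 + 2 * Real.pi * p.2 := by
  have : Measurable fun n : ℤ => (n : ℝ) := measurable_of_countable _
  fun_prop

theorem integrable_zigzagWeight_mul (hg : Integrable g m) (hψ : Measurable ψ) :
    Integrable (fun p : X × ℤ => (zigzagWeight (ψ p.1) p.2 : ℂ) * g p.1)
      (m.prod Measure.count) :=
  integrable_weighted (c := fun z n => zigzagWeight (ψ z) n) hg
    (fun n => (continuous_zigzagWeight n).measurable.comp hψ) (S := fun _ => 1)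
    (fun z => by simpa only [abs_of_nonneg (zigzagWeight_nonneg _ _)] using hasSum_zigzagWeight (ψ z))
    (fun _ => le_rfl)

theorem lintegral_zigzagWeight_mul (hg : Integrable g m) (hψ : Measurable ψ) :
    ∫⁻ p : X × ℤ, ‖(zigzagWeight (ψ p.1) p.2 : ℂ) * g p.1‖ₑ ∂m.prod Measure.count =
      ∫⁻ z, ‖g z‖ₑ ∂m := by
  rw [lintegral_enorm_weighted (c := fun z n => zigzagWeight (ψ z) n) hg.aestronglyMeasurable
    (fun n => (continuous_zigzagWeight n).measurable.comp hψ) (S := fun _ => 1)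
    (fun z => by simpa only [abs_of_nonneg (zigzagWeight_nonneg _ _)] using hasSum_zigzagWeight (ψ z))]
  simp

theorem zigzag_eq_integral [SFinite m] (hg : Integrable g m) (hψ : Measurable ψ)
    (hf : ∀ x : ℝ, f x = ∫ z, Complex.exp (Complex.I * x * ψ z) * g z ∂m) (x : ℝ) :
    zigzag f x = ∫ p : X × ℤ, Complex.exp (Complex.I * x * (ψ p.1 + 2 * Real.pi * p.2 : ℝ)) *
      ((zigzagWeight (ψ p.1) p.2 : ℂ) * g p.1) ∂m.prod Measure.count := by
  rw [zigzag_eq_integral_zigzag_mul hg hψ hf]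
  exact (integral_exp_mul_weighted (integrable_zigzagWeight_mul hg hψ)
    (measurable_add_two_pi_mul hψ) x fun z => hasSum_zigzagWeight_mul_exp (ψ z) x).symm

/-- The identity corresponds to the weights δ_{n0}, so the difference is represented by the weights
δ_{n0} - w_n, of absolute sum 2(1 - w_0). -/
theorem normW_sub_zigzag_le [SFinite m] (hg : Integrable g m) (hψ : Measurable ψ)
    (hf : ∀ x : ℝ, f x = ∫ z, Complex.exp (Complex.I * x * ψ z) * g z ∂m) :
    normW (fun x => f x - zigzag f x) ≤
      ∫⁻ z, ENNReal.ofReal (2 * (1 - zigzagWeight (ψ z) 0)) * ‖g z‖ₑ ∂m ∧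
    (fun x => f x - zigzag f x) ∈ W := by
  set c : X → ℤ → ℝ := fun z n => zigzagWeight (ψ z) n - if n = 0 then 1 else 0 with hc
  have hcm : ∀ n, Measurable fun z => c z n := fun n =>
    ((continuous_zigzagWeight n).measurable.comp hψ).sub_const _
  have hS : ∀ z, HasSum (fun n => |c z n|) (2 * (1 - zigzagWeight (ψ z) 0)) :=
    fun z => hasSum_abs_zigzagWeight_sub (ψ z)
  have hcg := integrable_weighted hg hcm hS (C := 2)
    fun z => by linarith [zigzagWeight_nonneg (ψ z) 0]
  have hφ := measurable_add_two_pi_mul hψ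
  have hexp := integrable_exp_mul hg hψ
  have hrep : ∀ x : ℝ, f x - zigzag f x =
      ∫ p : X × ℤ, Complex.exp (Complex.I * x * (ψ p.1 + 2 * Real.pi * p.2 : ℝ)) *
        (-((c p.1 p.2 : ℂ) * g p.1)) ∂m.prod Measure.count := by
    intro x
    have hH : ∀ z, HasSum (fun n => (c z n : ℂ) *
        Complex.exp (Complex.I * x * (ψ z + 2 * Real.pi * n : ℝ)))
        (zigzag (fun t : ℝ => Complex.exp (Complex.I * t * ψ z)) x -
          Complex.exp (Complex.I * x * ψ z)) := by
      intro z
      convert! (hasSum_zigzagWeight_mul_exp (ψ z) x).sub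
        (hasSum_ite_eq (0 : ℤ) (Complex.exp (Complex.I * x * ψ z))) using 1
      funext n
      by_cases hn : n = 0
      · subst hn
        simp [hc, sub_mul]
      · simp [hc, hn]
    have h := integral_exp_mul_weighted hcg hφ x hH
    simp only [mul_neg, integral_neg]
    have hzi : Integrable
        (fun z => zigzag (fun t : ℝ => Complex.exp (Complex.I * t * ψ z)) x * g z) m := by
      refine ((hexp (⌊x⌋ : ℤ)).add (((hexp ((⌊x⌋ + 1 : ℤ) : ℝ)).sub
        (hexp (⌊x⌋ : ℤ))).const_mul ((Int.fract x : ℝ) : ℂ))).congr (Eventually.of_forall fun z => ?_)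
      simp only [zigzag, Pi.add_apply, Pi.sub_apply]
      ring
    have hsub := integral_sub hzi (hexp x)
    simp only [← sub_mul] at hsub
    refine Eq.trans ?_ (congrArg Neg.neg (hsub.symm.trans h.symm))
    rw [← zigzag_eq_integral_zigzag_mul hg hψ hf, ← hf, neg_sub]
  refine ⟨?_, _, isFourierIntegralOf_map_withDensityᵥ hcg.neg hφ hrep⟩
  refine (normW_le_lintegral hcg.neg hφ hrep).trans_eq ?_
  simp only [Pi.neg_apply, enorm_neg]
  exact lintegral_enorm_weighted hg.aestronglyMeasurable hcm hS

end Representation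

/-! ### Norm bound, dilations and invariant classes -/

theorem zigzag_mem_W {f : ℝ → ℂ} (hf : f ∈ W) :
    zigzag f ∈ W ∧ normW (zigzag f) ≤ normW f := by
  obtain ⟨m, _, g, hg, h⟩ := exists_density_of_mem_W hf
  have hG := integrable_zigzagWeight_mul hg measurable_id
  have hφ := measurable_add_two_pi_mul (measurable_id (α := ℝ))
  have hz := zigzag_eq_integral hg measurable_id h
  refine ⟨⟨_, isFourierIntegralOf_map_withDensityᵥ hG hφ hz⟩, ?_⟩
  rw [normW_eq_lintegral hg h, ← lintegral_zigzagWeight_mul hg measurable_id]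
  exact normW_le_lintegral hG hφ hz

theorem comp_mul_eq_integral {m : Measure ℝ} {g : ℝ → ℂ} {f : ℝ → ℂ}
    (hf : ∀ x : ℝ, f x = ∫ y, Complex.exp (Complex.I * x * y) * g y ∂m) (h x : ℝ) :
    f (h * x) = ∫ y, Complex.exp (Complex.I * x * (h * y : ℝ)) * g y ∂m := by
  rw [hf]
  congr with y
  push_cast
  ring_nf

theorem comp_mul_mem_W {f : ℝ → ℂ} (hf : f ∈ W) (h : ℝ) :
    (fun x => f (h * x)) ∈ W ∧ normW (fun x => f (h * x)) ≤ normW f := by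
  obtain ⟨m, _, g, hg, hfg⟩ := exists_density_of_mem_W hf
  have hrep := comp_mul_eq_integral hfg h
  refine ⟨⟨_, isFourierIntegralOf_map_withDensityᵥ hg (measurable_const_mul h) hrep⟩, ?_⟩
  rw [normW_eq_lintegral hg hfg]
  exact normW_le_lintegral hg (measurable_const_mul h) hrep

theorem tendsto_normW_zigzag_comp_mul {f : ℝ → ℂ} (hf : f ∈ W) :
    Tendsto (fun h : ℝ => normW (zigzag fun x => f (h * x))) (𝓝[>] 0) (𝓝 (normW f)) := by
  obtain ⟨m, _, g, hg, hfg⟩ := exists_density_of_mem_W hf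
  set ε : ℝ → ℝ≥0∞ := fun h =>
    ∫⁻ y, ENNReal.ofReal (2 * (1 - zigzagWeight (h * y) 0)) * ‖g y‖ₑ ∂m with hε
  have hw := continuous_zigzagWeight 0
  have hlim : Tendsto ε (𝓝[>] 0) (𝓝 0) := by
    have : (0 : ℝ≥0∞) = ∫⁻ _, 0 ∂m := by simp
    rw [this]
    refine tendsto_lintegral_filter_of_dominated_convergence' (fun y => ENNReal.ofReal 2 * ‖g y‖ₑ)
      (Eventually.of_forall fun h => ?_) (Eventually.of_forall fun h =>
        Eventually.of_forall fun y => ?_) ?_ (Eventually.of_forall fun y => ?_)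
    · exact AEMeasurable.mul (by fun_prop) hg.aestronglyMeasurable.enorm
    · gcongr
      linarith [zigzagWeight_nonneg (h * y) 0]
    · rw [lintegral_const_mul' _ _ ENNReal.ofReal_ne_top]
      exact (ENNReal.mul_lt_top ENNReal.ofReal_lt_top hg.2).ne
    · have hc : Continuous fun h : ℝ => ENNReal.ofReal (2 * (1 - zigzagWeight (h * y) 0)) :=
        ENNReal.continuous_ofReal.comp (by fun_prop)
      have h0 := ENNReal.Tendsto.mul_const (b := ‖g y‖ₑ) ((hc.tendsto 0).mono_left
        (nhdsWithin_le_nhds (s := Ioi 0))) (Or.inr enorm_ne_top)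
      simpa [zigzagWeight] using h0
  have hfin : normW f ≠ ∞ := by
    rw [normW_eq_lintegral hg hfg]
    exact hg.2.ne
  have hlow : Tendsto (fun h => normW f - ε h) (𝓝[>] 0) (𝓝 (normW f)) := by
    simpa using ENNReal.Tendsto.sub tendsto_const_nhds hlim (Or.inl hfin)
  refine tendsto_of_tendsto_of_tendsto_of_le_of_le' hlow tendsto_const_nhds ?_ ?_
  · filter_upwards [self_mem_nhdsWithin] with h hh
    have hh0 : h ≠ 0 := (mem_Ioi.1 hh).ne'
    have hfh := (comp_mul_mem_W hf h).1
    -- Dilating back by 1/h shows that dilation does not decrease the norm; the triangle inequality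
    -- then gives ‖f‖ ≤ ‖zigzag f_h‖ + ε(h).
    have h1 : normW f ≤ normW fun x => f (h * x) := by
      have := (comp_mul_mem_W hfh h⁻¹).2
      simpa only [mul_inv_cancel_left₀ hh0] using this
    obtain ⟨hle, hmem⟩ := normW_sub_zigzag_le hg (measurable_const_mul h)
      (comp_mul_eq_integral hfg h)
    rw [tsub_le_iff_right]
    refine h1.trans ((normW_le_add (zigzag_mem_W hfh).1 hmem fun x => ?_).trans (by gcongr))
    ring
  · exact Eventually.of_forall fun h =>
      (zigzag_mem_W (comp_mul_mem_W hf h).1).2.trans (comp_mul_mem_W hf h).2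

theorem zigzag_mem_W₀ {f : ℝ → ℂ} (hf : f ∈ W₀) : zigzag f ∈ W₀ := by
  obtain ⟨g, hg, h⟩ := hf
  have hG := integrable_zigzagWeight_mul hg measurable_id
  have hφ := measurable_add_two_pi_mul (measurable_id (α := ℝ))
  have hν := isFourierIntegralOf_map_withDensityᵥ hG hφ (zigzag_eq_integral hg measurable_id h)
  refine hν.exists_density volume fun E hE h0 => ?_
  rw [VectorMeasure.map_apply _ hφ hE, withDensityᵥ_apply hG (hφ hE)]
  refine setIntegral_measure_zero _ ?_
  -- For each fixed n the slice of the preimage is a translate of the null set E, so the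
  -- pushed-forward measure is absolutely continuous.
  rw [Measure.prod_apply_symm (hφ hE)]
  simp [preimage_preimage, h0]

theorem zigzag_mem_W₁ {f : ℝ → ℂ} (hf : f ∈ W₁) : zigzag f ∈ W₁ := by
  obtain ⟨c, f₀, hf₀, h⟩ := hf
  refine ⟨c, zigzag f₀, zigzag_mem_W₀ hf₀, fun x => ?_⟩
  simp only [zigzag, h]
  ring

theorem zigzag_mem_Wplus {f : ℝ → ℂ} (hf : f ∈ Wplus) : zigzag f ∈ Wplus := by
  obtain ⟨μ, _, h⟩ := hf
  have hg : Integrable (fun _ : ℝ => (1 : ℂ)) μ := integrable_const 1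
  have hφ := measurable_add_two_pi_mul (measurable_id (α := ℝ))
  simp only [id] at hφ
  have hz := zigzag_eq_integral hg measurable_id fun x => by simpa using h x
  have hw : Measurable fun p : ℝ × ℤ => ENNReal.ofReal (zigzagWeight p.1 p.2) :=
    ENNReal.measurable_ofReal.comp
      (measurable_from_prod_countable_left fun n => (continuous_zigzagWeight n).measurable)
  -- The weights are nonnegative, so the representing measure can be built as a positive one; its
  -- total mass is that of μ.
  refine ⟨((μ.prod Measure.count).withDensity fun p : ℝ × ℤ =>
    ENNReal.ofReal (zigzagWeight p.1 p.2)).map fun p => p.1 + 2 * Real.pi * p.2, ?_, fun x => ?_⟩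
  · have hfin := lintegral_zigzagWeight_mul hg measurable_id
    have : IsFiniteMeasure ((μ.prod Measure.count).withDensity fun p : ℝ × ℤ =>
        ENNReal.ofReal (zigzagWeight p.1 p.2)) := by
      refine isFiniteMeasure_withDensity ?_
      have he : ∀ p : ℝ × ℤ, ENNReal.ofReal (zigzagWeight p.1 p.2) =
          ‖(zigzagWeight (id p.1) p.2 : ℂ) * 1‖ₑ := fun p => by
        rw [mul_one, ← ofReal_norm, Complex.norm_real,
          Real.norm_of_nonneg (zigzagWeight_nonneg _ _), id]
      simp only [he, hfin]
      simp
    infer_instance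
  · rw [integral_map hφ.aemeasurable (by fun_prop),
      integral_withDensity_eq_integral_toReal_smul hw
      (Eventually.of_forall fun p => ENNReal.ofReal_lt_top), hz]
    refine integral_congr_ae (Eventually.of_forall fun p => ?_)
    simp only [ENNReal.toReal_ofReal (zigzagWeight_nonneg _ _), Complex.real_smul, id, mul_one]
    rw [mul_comm]

/-- The constant function 1, represented by the unit mass at 0, is its own zigzag. -/
theorem one_le_of_normW_zigzag_le {C : ℝ≥0∞}
    (hC : ∀ f ∈ W, normW (zigzag f) ≤ C * normW f) : 1 ≤ C := by
  have hone : ∀ x : ℝ, (fun _ : ℝ => (1 : ℂ)) x =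
      ∫ y : ℝ, Complex.exp (Complex.I * x * y) * 1 ∂Measure.dirac 0 := by simp
  have hi : Integrable (fun _ : ℝ => (1 : ℂ)) (Measure.dirac 0) := integrable_const 1
  have hmem : (fun _ : ℝ => (1 : ℂ)) ∈ W :=
    ⟨_, isFourierIntegralOf_map_withDensityᵥ hi measurable_id hone⟩
  have hnorm : normW (fun _ : ℝ => (1 : ℂ)) = 1 := by
    rw [normW_eq_lintegral hi hone]
    simp
  have hz : zigzag (fun _ : ℝ => (1 : ℂ)) = fun _ => 1 := by
    funext x
    simp [zigzag]
  simpa [hz, hnorm] using hC _ hmem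

end WienerAlgebra

theorem theorem2 :
    (∀ f ∈ WienerAlgebra.W,
      WienerAlgebra.zigzag f ∈ WienerAlgebra.W ∧
        WienerAlgebra.normW (WienerAlgebra.zigzag f) ≤ WienerAlgebra.normW f) ∧
    (∀ C : ℝ≥0∞,
      (∀ f ∈ WienerAlgebra.W,
        WienerAlgebra.normW (WienerAlgebra.zigzag f) ≤ C * WienerAlgebra.normW f) → 1 ≤ C) ∧
    (∀ f ∈ WienerAlgebra.W,
      Tendsto (fun h : ℝ => WienerAlgebra.normW (WienerAlgebra.zigzag (fun x : ℝ => f (h * x))))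
        (𝓝[>] 0) (𝓝 (WienerAlgebra.normW f))) ∧
    (∀ f ∈ WienerAlgebra.W₀, WienerAlgebra.zigzag f ∈ WienerAlgebra.W₀) ∧
    (∀ f ∈ WienerAlgebra.W₁, WienerAlgebra.zigzag f ∈ WienerAlgebra.W₁) ∧
    (∀ f ∈ WienerAlgebra.Wplus, WienerAlgebra.zigzag f ∈ WienerAlgebra.Wplus) :=
  ⟨fun _ hf => WienerAlgebra.zigzag_mem_W hf,
    fun _ hC => WienerAlgebra.one_le_of_normW_zigzag_le hC,
    fun _ hf => WienerAlgebra.tendsto_normW_zigzag_comp_mul hf,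
    fun _ hf => WienerAlgebra.zigzag_mem_W₀ hf,
    fun _ hf => WienerAlgebra.zigzag_mem_W₁ hf,
    fun _ hf => WienerAlgebra.zigzag_mem_Wplus hf⟩
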